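/- **Languages.** Fix a first-order language with variables, individual constants, for every $n>0$ countably many $n$-place predicate letters, and identity $=$; there are no function symbols, so terms are variables and constants. In the negative free versions there is also a one-place existence predicate $\mathcal{E}$. "Predicate" means a predicate letter, $=$, or (in the free versions) $\mathcal{E}$. Let $L^\neg$ be the set of formulas built from atoms by $\neg,\wedge,\vee,\rightarrow,\forall,\exists$. Let $L^\bot$ be the set of formulas built by $\bot,\wedge,\vee,\rightarrow,\forall,\exists$ from atoms in the vocabulary extended by a fresh predicate $P'$ of the same arity for every predicate $P$ (including $='$ and, in the free versions, $\mathcal{E}'$). $A^x_t$ is the result of substituting $t$ for the free occurrences of $x$ in $A$, where $t$ is required to be free for $x$ in $A$. **Int** is the Gentzen–Prawitz natural deduction system on $L^\bot$ with the usual introduction and elimination rules for $\wedge,\vee,\rightarrow,\forall,\exists$ (with the usual eigenvariable conditions), $\bot/B$, the axiom $t=t$, and $t_1=t_2,\ A^x_{t_1}\,/\,A^x_{t_2}$ for atomic $A$. **N4** is the system on $L^\neg$ with the same positive rules (no $\bot$ rule), where the identity elimination rule is allowed for $A$ an atom or a negated atom, and with introduction and elimination rules for negated compounds: $\neg\neg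 A$ is treated like $A$; $\neg(A\to B)$ like $A\wedge\neg B$; $\neg(A\wedge B)$ like $\neg A\vee\neg B$; $\neg(A\vee B)$ like $\neg A\wedge\neg B$; $\neg\forall xA$ like $\exists x\neg A$; $\neg\exists xA$ like $\forall x\neg A$. The negative free versions $\mathbf{Int}^{NF}$ and $\mathbf{N4}^{NF}$ are obtained as follows. The rules $(\forall E),(\exists I)$ and, in $\mathbf{N4}^{NF}$, $(\neg\exists E),(\neg\forall I)$ get the extra premise $\mathcal{E}t$. The rules $(\forall I),(\exists E)$ and, in $\mathbf{N4}^{NF}$, $(\neg\exists I),(\neg\forall E)$ may discharge the extra assumption $\mathcal{E}y$ for the eigenvariable $y$. The axiom $t=t$ is replaced by the rule $\mathcal{E}t\,/\,t=t$. Finally, the denotation rules are added: in $\mathbf{N4}^{NF}$, $P(t_1,\dots,t_n)/\mathcal{E}t_i$ and $\neg P(t_1,\dots,t_n)/\mathcal{E}t_i$; in $\mathbf{Int}^{NF}$, $P(t_1,\dots,t_n)/\mathcal{E}t_i$ and $P'(t_1,\dots,t_n)/\mathcal{E}t_i$. Here $P$ ranges either over all predicates, or over all predicates other than $\mathcal{E}$;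 the choice is the same in both systems, and the theorem holds for either choice. **Translation.** Define $\tau:L^\neg\to L^\bot$ by - $\tau(P(t_1,\dots,t_n))=P(t_1,\dots,t_n)$ and $\tau(\neg P(t_1,\dots,t_n))=P'(t_1,\dots,t_n)$ for every predicate $P$; - $\tau(A\ast B)=\tau(A)\ast\tau(B)$ for $\ast\in\{\to,\wedge,\vee\}$; - $\tau(\neg\neg A)=\tau(A)$; - $\tau(\neg(A\to B))=\tau(A)\wedge\tau(\neg B)$; - $\tau(\neg(A\wedge B))=\tau(\neg A)\vee\tau(\neg B)$; - $\tau(\neg(A\vee B))=\tau(\neg A)\wedge\tau(\neg B)$; - $\tau(QxA)=Qx\,\tau(A)$ for $Q\in\{\forall,\exists\}$; - $\tau(\neg\forall xA)=\exists x\,\tau(\neg A)$; - $\tau(\neg\exists xA)=\forall x\,\tau(\neg A)$. **Theorem (syntactical embedding).** For every formula $A$ of $L^\neg$ without $\mathcal{E}$: $\vdash_{\mathbf{N4}}A$ if and only if $\vdash_{\mathbf{Int}}\tau(A)$. For every formula $A$ of $L^\neg$ (with $\mathcal{E}$): $\vdash_{\mathbf{N4}^{NF}}A$ if and only if $\vdash_{\mathbf{Int}^{NF}}\tau(A)$.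 -/

import Mathlib

namespace Nelson

/-! ### The languages -/

/-- The versions of the logics: the ordinary one and the negative free one.  The flag `e` of the
negative free version says whether the existence predicate itself is counted among the predicates
to which the denotation rules (PD) and (negated PD) apply (`true`: it is; `false`: these rules
are for the predicate letters and identity only). -/
inductive Version : Type
  | ordinary
  | free (e : Bool)

/-- Terms: variables and individual constants. -/
inductive Term : Type
  | var (x : ℕ)
  | const (k : ℕ)

/-- Predicates of the Nelsonian language: for every positive arity `n + 1` the predicate letters
with index `i : ℕ`, identity and, in the free version only, the existence predicate. -/
inductive Pred : Version → Type
  | letter {v : Version} (n i : ℕ) : Pred v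
  | eq {v : Version} : Pred v
  | exist {e : Bool} : Pred (.free e)

/-- The number of places of a predicate. -/
@[reducible] def Pred.arity {v : Version} : Pred v → ℕ
  | .letter n _ => n + 1
  | .eq => 2
  | .exist => 1

/-- The predicates to which the denotation rules of the free version apply. -/
def Pred.Denotes {e : Bool} : Pred (.free e) → Prop
  | .letter _ _ => True
  | .eq => True
  | .exist => e = true

/-- Predicates of the extended intuitionistic language: every predicate `P` of the Nelsonian
language and a fresh copy `P'` of it, of the same arity. -/
inductive IPred (v : Version) : Type
  | plain (P : Pred v)
  | primed (P : Pred v)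

/-- The number of places of a predicate of the extended intuitionistic language. -/
@[reducible] def IPred.arity {v : Version} : IPred v → ℕ
  | .plain P => P.arity
  | .primed P => P.arity

/-- The predicates of the extended language to which the rule (PD) applies. -/
def IPred.Denotes {e : Bool} : IPred (.free e) → Prop
  | .plain P => P.Denotes
  | .primed P => P.Denotes

/-- Formulas of the Nelsonian language (with strong negation, without falsum). -/
inductive NForm (v : Version) : Type
  | atom (P : Pred v) (ts : Fin P.arity → Term)
  | neg (A : NForm v)
  | and (A B : NForm v)
  | or (A B : NForm v)
  | imp (A B : NForm v)
  | all (x : ℕ) (A : NForm v)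
  | ex (x : ℕ) (A : NForm v)

/-- Formulas of the extended intuitionistic language (with falsum, without negation). -/
inductive IForm (v : Version) : Type
  | atom (P : IPred v) (ts : Fin P.arity → Term)
  | bot
  | and (A B : IForm v)
  | or (A B : IForm v)
  | imp (A B : IForm v)
  | all (x : ℕ) (A : IForm v)
  | ex (x : ℕ) (A : IForm v)

/-! ### Substitution and free variables -/

/-- `s.subst x t` replaces the variable `x` by the term `t` in the term `s`. -/
def Term.subst (s : Term) (x : ℕ) (t : Term) : Term :=
  match s with
  | .var y => if y = x then t else .var y
  | .const k => .const k

namespace NForm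

variable {v : Version}

/-- The atomic formula `s = t`. -/
def eq (s t : Term) : NForm v := .atom .eq ![s, t]

/-- The atomic formula saying that `t` exists. -/
def exist {e : Bool} (t : Term) : NForm (.free e) := .atom .exist ![t]

/-- `A.subst x t` replaces all free occurrences of `x` in `A` by `t`, with no renaming. -/
def subst (x : ℕ) (t : Term) : NForm v → NForm v
  | .atom P ts => .atom P (fun i => (ts i).subst x t)
  | .neg A => .neg (A.subst x t)
  | .and A B => .and (A.subst x t) (B.subst x t)
  | .or A B => .or (A.subst x t) (B.subst x t)
  | .imp A B => .imp (A.subst x t) (B.subst x t)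
  | .all y A => .all y (if y = x then A else A.subst x t)
  | .ex y A => .ex y (if y = x then A else A.subst x t)

/-- `A.IsFree x`: the variable `x` occurs free in `A`. -/
def IsFree (x : ℕ) : NForm v → Prop
  | .atom _ ts => ∃ i, ts i = .var x
  | .neg A => A.IsFree x
  | .and A B => A.IsFree x ∨ B.IsFree x
  | .or A B => A.IsFree x ∨ B.IsFree x
  | .imp A B => A.IsFree x ∨ B.IsFree x
  | .all y A => y ≠ x ∧ A.IsFree x
  | .ex y A => y ≠ x ∧ A.IsFree x

/-- `A.FreeFor t x`: the term `t` is free for `x` in `A`, i.e. no variable of `t` becomes bound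
when `t` is substituted for the free occurrences of `x` in `A`. -/
def FreeFor (t : Term) (x : ℕ) : NForm v → Prop
  | .atom _ _ => True
  | .neg A => A.FreeFor t x
  | .and A B => A.FreeFor t x ∧ B.FreeFor t x
  | .or A B => A.FreeFor t x ∧ B.FreeFor t x
  | .imp A B => A.FreeFor t x ∧ B.FreeFor t x
  | .all y A => (y ≠ x ∧ A.IsFree x) → (t ≠ .var y ∧ A.FreeFor t x)
  | .ex y A => (y ≠ x ∧ A.IsFree x) → (t ≠ .var y ∧ A.FreeFor t x)

/-- `A.Eigen x y`: the variable `y` may serve as the eigenvariable of a rule for a quantifier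
binding `x` in front of `A`: `y` is free for `x` in `A`, and either `y` is `x` or `y` is not
free in `A`. -/
def Eigen (A : NForm v) (x y : ℕ) : Prop :=
  A.FreeFor (.var y) x ∧ (y = x ∨ ¬ A.IsFree y)

end NForm

namespace IForm

variable {v : Version}

/-- The atomic formula `s = t`. -/
def eq (s t : Term) : IForm v := .atom (.plain .eq) ![s, t]

/-- The atomic formula saying that `t` exists. -/
def exist {e : Bool} (t : Term) : IForm (.free e) := .atom (.plain .exist) ![t]

/-- `A.subst x t` replaces all free occurrences of `x` in `A` by `t`, with no renaming. -/
def subst (x : ℕ) (t : Term) : IForm v → IForm v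
  | .atom P ts => .atom P (fun i => (ts i).subst x t)
  | .bot => .bot
  | .and A B => .and (A.subst x t) (B.subst x t)
  | .or A B => .or (A.subst x t) (B.subst x t)
  | .imp A B => .imp (A.subst x t) (B.subst x t)
  | .all y A => .all y (if y = x then A else A.subst x t)
  | .ex y A => .ex y (if y = x then A else A.subst x t)

/-- `A.IsFree x`: the variable `x` occurs free in `A`. -/
def IsFree (x : ℕ) : IForm v → Prop
  | .atom _ ts => ∃ i, ts i = .var x
  | .bot => False
  | .and A B => A.IsFree x ∨ B.IsFree x
  | .or A B => A.IsFree x ∨ B.IsFree x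
  | .imp A B => A.IsFree x ∨ B.IsFree x
  | .all y A => y ≠ x ∧ A.IsFree x
  | .ex y A => y ≠ x ∧ A.IsFree x

/-- `A.FreeFor t x`: the term `t` is free for `x` in `A`. -/
def FreeFor (t : Term) (x : ℕ) : IForm v → Prop
  | .atom _ _ => True
  | .bot => True
  | .and A B => A.FreeFor t x ∧ B.FreeFor t x
  | .or A B => A.FreeFor t x ∧ B.FreeFor t x
  | .imp A B => A.FreeFor t x ∧ B.FreeFor t x
  | .all y A => (y ≠ x ∧ A.IsFree x) → (t ≠ .var y ∧ A.FreeFor t x)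
  | .ex y A => (y ≠ x ∧ A.IsFree x) → (t ≠ .var y ∧ A.FreeFor t x)

/-- `A.Eigen x y`: the variable `y` may serve as the eigenvariable of a rule for a quantifier
binding `x` in front of `A`. -/
def Eigen (A : IForm v) (x y : ℕ) : Prop :=
  A.FreeFor (.var y) x ∧ (y = x ∨ ¬ A.IsFree y)

end IForm

/-! ### Natural deduction for Nelson's logic -/

/-- `N4Der Γ A`: there is a natural deduction of `A` in Nelson's logic all of whose undischarged
assumptions belong to `Γ`.  The logic is the ordinary or the negative free one according to the
version over which the formulas are built; rules stated for `Version.ordinary` (with primed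
names) or for `Version.free e` belong to that version only. -/
inductive N4Der : {v : Version} → Set (NForm v) → NForm v → Prop
  | assumption {v : Version} {Γ : Set (NForm v)} {A : NForm v} : A ∈ Γ → N4Der Γ A
  | weakening {v : Version} {Γ Δ : Set (NForm v)} {A : NForm v} :
      Γ ⊆ Δ → N4Der Γ A → N4Der Δ A
  -- connectives
  | orI₁ {v : Version} {Γ : Set (NForm v)} {A B : NForm v} : N4Der Γ A → N4Der Γ (.or A B)
  | orI₂ {v : Version} {Γ : Set (NForm v)} {A B : NForm v} : N4Der Γ B → N4Der Γ (.or A B)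
  | orE {v : Version} {Γ : Set (NForm v)} {A B C : NForm v} :
      N4Der Γ (.or A B) → N4Der (insert A Γ) C → N4Der (insert B Γ) C → N4Der Γ C
  | impI {v : Version} {Γ : Set (NForm v)} {A B : NForm v} :
      N4Der (insert A Γ) B → N4Der Γ (.imp A B)
  | impE {v : Version} {Γ : Set (NForm v)} {A B : NForm v} :
      N4Der Γ (.imp A B) → N4Der Γ A → N4Der Γ B
  | andI {v : Version} {Γ : Set (NForm v)} {A B : NForm v} :
      N4Der Γ A → N4Der Γ B → N4Der Γ (.and A B)
  | andE₁ {v : Version} {Γ : Set (NForm v)} {A B : NForm v} : N4Der Γ (.and A B) → N4Der Γ A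
  | andE₂ {v : Version} {Γ : Set (NForm v)} {A B : NForm v} : N4Der Γ (.and A B) → N4Der Γ B
  -- negated connectives
  | negNegI {v : Version} {Γ : Set (NForm v)} {A : NForm v} : N4Der Γ A → N4Der Γ (.neg (.neg A))
  | negNegE {v : Version} {Γ : Set (NForm v)} {A : NForm v} : N4Der Γ (.neg (.neg A)) → N4Der Γ A
  | negImpI {v : Version} {Γ : Set (NForm v)} {A B : NForm v} :
      N4Der Γ A → N4Der Γ (.neg B) → N4Der Γ (.neg (.imp A B))
  | negImpE₁ {v : Version} {Γ : Set (NForm v)} {A B : NForm v} :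
      N4Der Γ (.neg (.imp A B)) → N4Der Γ A
  | negImpE₂ {v : Version} {Γ : Set (NForm v)} {A B : NForm v} :
      N4Der Γ (.neg (.imp A B)) → N4Der Γ (.neg B)
  | negOrI {v : Version} {Γ : Set (NForm v)} {A B : NForm v} :
      N4Der Γ (.neg A) → N4Der Γ (.neg B) → N4Der Γ (.neg (.or A B))
  | negOrE₁ {v : Version} {Γ : Set (NForm v)} {A B : NForm v} :
      N4Der Γ (.neg (.or A B)) → N4Der Γ (.neg A)
  | negOrE₂ {v : Version} {Γ : Set (NForm v)} {A B : NForm v} :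
      N4Der Γ (.neg (.or A B)) → N4Der Γ (.neg B)
  | negAndI₁ {v : Version} {Γ : Set (NForm v)} {A B : NForm v} :
      N4Der Γ (.neg A) → N4Der Γ (.neg (.and A B))
  | negAndI₂ {v : Version} {Γ : Set (NForm v)} {A B : NForm v} :
      N4Der Γ (.neg B) → N4Der Γ (.neg (.and A B))
  | negAndE {v : Version} {Γ : Set (NForm v)} {A B C : NForm v} :
      N4Der Γ (.neg (.and A B)) → N4Der (insert (.neg A) Γ) C → N4Der (insert (.neg B) Γ) C →
      N4Der Γ C
  -- quantifiers, free version
  | allI {e : Bool} {Γ : Set (NForm (.free e))} {A : NForm (.free e)} {x y : ℕ} :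
      A.Eigen x y → (∀ B ∈ Γ, ¬ B.IsFree y) →
      N4Der (insert (.exist (.var y)) Γ) (A.subst x (.var y)) → N4Der Γ (.all x A)
  | allE {e : Bool} {Γ : Set (NForm (.free e))} {A : NForm (.free e)} {x : ℕ} {t : Term} :
      A.FreeFor t x → N4Der Γ (.all x A) → N4Der Γ (.exist t) → N4Der Γ (A.subst x t)
  | negAllI {e : Bool} {Γ : Set (NForm (.free e))} {A : NForm (.free e)} {x : ℕ} {t : Term} :
      A.FreeFor t x → N4Der Γ (.neg (A.subst x t)) → N4Der Γ (.exist t) →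
      N4Der Γ (.neg (.all x A))
  | negAllE {e : Bool} {Γ Δ : Set (NForm (.free e))} {A C : NForm (.free e)} {x y : ℕ} :
      A.Eigen x y → ¬ C.IsFree y → (∀ B ∈ Δ, ¬ B.IsFree y) →
      N4Der Γ (.neg (.all x A)) →
      N4Der (insert (.neg (A.subst x (.var y))) (insert (.exist (.var y)) Δ)) C →
      N4Der (Γ ∪ Δ) C
  | exI {e : Bool} {Γ : Set (NForm (.free e))} {A : NForm (.free e)} {x : ℕ} {t : Term} :
      A.FreeFor t x → N4Der Γ (A.subst x t) → N4Der Γ (.exist t) → N4Der Γ (.ex x A)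
  | exE {e : Bool} {Γ Δ : Set (NForm (.free e))} {A C : NForm (.free e)} {x y : ℕ} :
      A.Eigen x y → ¬ C.IsFree y → (∀ B ∈ Δ, ¬ B.IsFree y) →
      N4Der Γ (.ex x A) →
      N4Der (insert (A.subst x (.var y)) (insert (.exist (.var y)) Δ)) C →
      N4Der (Γ ∪ Δ) C
  | negExI {e : Bool} {Γ : Set (NForm (.free e))} {A : NForm (.free e)} {x y : ℕ} :
      A.Eigen x y → (∀ B ∈ Γ, ¬ B.IsFree y) →
      N4Der (insert (.exist (.var y)) Γ) (.neg (A.subst x (.var y))) → N4Der Γ (.neg (.ex x A))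
  | negExE {e : Bool} {Γ : Set (NForm (.free e))} {A : NForm (.free e)} {x : ℕ} {t : Term} :
      A.FreeFor t x → N4Der Γ (.neg (.ex x A)) → N4Der Γ (.exist t) →
      N4Der Γ (.neg (A.subst x t))
  -- quantifiers, ordinary version
  | allI' {Γ : Set (NForm .ordinary)} {A : NForm .ordinary} {x y : ℕ} :
      A.Eigen x y → (∀ B ∈ Γ, ¬ B.IsFree y) →
      N4Der Γ (A.subst x (.var y)) → N4Der Γ (.all x A)
  | allE' {Γ : Set (NForm .ordinary)} {A : NForm .ordinary} {x : ℕ} {t : Term} :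
      A.FreeFor t x → N4Der Γ (.all x A) → N4Der Γ (A.subst x t)
  | negAllI' {Γ : Set (NForm .ordinary)} {A : NForm .ordinary} {x : ℕ} {t : Term} :
      A.FreeFor t x → N4Der Γ (.neg (A.subst x t)) → N4Der Γ (.neg (.all x A))
  | negAllE' {Γ Δ : Set (NForm .ordinary)} {A C : NForm .ordinary} {x y : ℕ} :
      A.Eigen x y → ¬ C.IsFree y → (∀ B ∈ Δ, ¬ B.IsFree y) →
      N4Der Γ (.neg (.all x A)) → N4Der (insert (.neg (A.subst x (.var y))) Δ) C →
      N4Der (Γ ∪ Δ) C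
  | exI' {Γ : Set (NForm .ordinary)} {A : NForm .ordinary} {x : ℕ} {t : Term} :
      A.FreeFor t x → N4Der Γ (A.subst x t) → N4Der Γ (.ex x A)
  | exE' {Γ Δ : Set (NForm .ordinary)} {A C : NForm .ordinary} {x y : ℕ} :
      A.Eigen x y → ¬ C.IsFree y → (∀ B ∈ Δ, ¬ B.IsFree y) →
      N4Der Γ (.ex x A) → N4Der (insert (A.subst x (.var y)) Δ) C →
      N4Der (Γ ∪ Δ) C
  | negExI' {Γ : Set (NForm .ordinary)} {A : NForm .ordinary} {x y : ℕ} :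
      A.Eigen x y → (∀ B ∈ Γ, ¬ B.IsFree y) →
      N4Der Γ (.neg (A.subst x (.var y))) → N4Der Γ (.neg (.ex x A))
  | negExE' {Γ : Set (NForm .ordinary)} {A : NForm .ordinary} {x : ℕ} {t : Term} :
      A.FreeFor t x → N4Der Γ (.neg (.ex x A)) → N4Der Γ (.neg (A.subst x t))
  -- identity; its elimination is for atomic formulas and negated atomic formulas
  | eqI {e : Bool} {Γ : Set (NForm (.free e))} {t : Term} :
      N4Der Γ (.exist t) → N4Der Γ (.eq t t)
  | eqI' {Γ : Set (NForm .ordinary)} {t : Term} : N4Der Γ (.eq t t)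
  | eqE {v : Version} {Γ : Set (NForm v)} {P : Pred v} {ts : Fin P.arity → Term} {x : ℕ}
      {t₁ t₂ : Term} :
      N4Der Γ (.eq t₁ t₂) → N4Der Γ ((NForm.atom P ts).subst x t₁) →
      N4Der Γ ((NForm.atom P ts).subst x t₂)
  | eqENeg {v : Version} {Γ : Set (NForm v)} {P : Pred v} {ts : Fin P.arity → Term} {x : ℕ}
      {t₁ t₂ : Term} :
      N4Der Γ (.eq t₁ t₂) → N4Der Γ ((NForm.neg (.atom P ts)).subst x t₁) →
      N4Der Γ ((NForm.neg (.atom P ts)).subst x t₂)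
  -- predicates, free version
  | pd {e : Bool} {Γ : Set (NForm (.free e))} {P : Pred (.free e)} {ts : Fin P.arity → Term}
      (i : Fin P.arity) :
      P.Denotes → N4Der Γ (.atom P ts) → N4Der Γ (.exist (ts i))
  | negPd {e : Bool} {Γ : Set (NForm (.free e))} {P : Pred (.free e)} {ts : Fin P.arity → Term}
      (i : Fin P.arity) :
      P.Denotes → N4Der Γ (.neg (.atom P ts)) → N4Der Γ (.exist (ts i))

/-! ### Natural deduction for intuitionistic logic -/

/-- `IntDer Γ A`: there is a natural deduction of `A` in intuitionistic logic (ordinary or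
negative free, according to the version) all of whose undischarged assumptions belong to `Γ`. -/
inductive IntDer : {v : Version} → Set (IForm v) → IForm v → Prop
  | assumption {v : Version} {Γ : Set (IForm v)} {A : IForm v} : A ∈ Γ → IntDer Γ A
  | weakening {v : Version} {Γ Δ : Set (IForm v)} {A : IForm v} :
      Γ ⊆ Δ → IntDer Γ A → IntDer Δ A
  -- connectives
  | botE {v : Version} {Γ : Set (IForm v)} {B : IForm v} : IntDer Γ .bot → IntDer Γ B
  | orI₁ {v : Version} {Γ : Set (IForm v)} {A B : IForm v} : IntDer Γ A → IntDer Γ (.or A B)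
  | orI₂ {v : Version} {Γ : Set (IForm v)} {A B : IForm v} : IntDer Γ B → IntDer Γ (.or A B)
  | orE {v : Version} {Γ : Set (IForm v)} {A B C : IForm v} :
      IntDer Γ (.or A B) → IntDer (insert A Γ) C → IntDer (insert B Γ) C → IntDer Γ C
  | impI {v : Version} {Γ : Set (IForm v)} {A B : IForm v} :
      IntDer (insert A Γ) B → IntDer Γ (.imp A B)
  | impE {v : Version} {Γ : Set (IForm v)} {A B : IForm v} :
      IntDer Γ (.imp A B) → IntDer Γ A → IntDer Γ B
  | andI {v : Version} {Γ : Set (IForm v)} {A B : IForm v} :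
      IntDer Γ A → IntDer Γ B → IntDer Γ (.and A B)
  | andE₁ {v : Version} {Γ : Set (IForm v)} {A B : IForm v} : IntDer Γ (.and A B) → IntDer Γ A
  | andE₂ {v : Version} {Γ : Set (IForm v)} {A B : IForm v} : IntDer Γ (.and A B) → IntDer Γ B
  -- quantifiers, free version
  | allI {e : Bool} {Γ : Set (IForm (.free e))} {A : IForm (.free e)} {x y : ℕ} :
      A.Eigen x y → (∀ B ∈ Γ, ¬ B.IsFree y) →
      IntDer (insert (.exist (.var y)) Γ) (A.subst x (.var y)) → IntDer Γ (.all x A)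
  | allE {e : Bool} {Γ : Set (IForm (.free e))} {A : IForm (.free e)} {x : ℕ} {t : Term} :
      A.FreeFor t x → IntDer Γ (.all x A) → IntDer Γ (.exist t) → IntDer Γ (A.subst x t)
  | exI {e : Bool} {Γ : Set (IForm (.free e))} {A : IForm (.free e)} {x : ℕ} {t : Term} :
      A.FreeFor t x → IntDer Γ (A.subst x t) → IntDer Γ (.exist t) → IntDer Γ (.ex x A)
  | exE {e : Bool} {Γ Δ : Set (IForm (.free e))} {A C : IForm (.free e)} {x y : ℕ} :
      A.Eigen x y → ¬ C.IsFree y → (∀ B ∈ Δ, ¬ B.IsFree y) →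
      IntDer Γ (.ex x A) →
      IntDer (insert (A.subst x (.var y)) (insert (.exist (.var y)) Δ)) C →
      IntDer (Γ ∪ Δ) C
  -- quantifiers, ordinary version
  | allI' {Γ : Set (IForm .ordinary)} {A : IForm .ordinary} {x y : ℕ} :
      A.Eigen x y → (∀ B ∈ Γ, ¬ B.IsFree y) →
      IntDer Γ (A.subst x (.var y)) → IntDer Γ (.all x A)
  | allE' {Γ : Set (IForm .ordinary)} {A : IForm .ordinary} {x : ℕ} {t : Term} :
      A.FreeFor t x → IntDer Γ (.all x A) → IntDer Γ (A.subst x t)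
  | exI' {Γ : Set (IForm .ordinary)} {A : IForm .ordinary} {x : ℕ} {t : Term} :
      A.FreeFor t x → IntDer Γ (A.subst x t) → IntDer Γ (.ex x A)
  | exE' {Γ Δ : Set (IForm .ordinary)} {A C : IForm .ordinary} {x y : ℕ} :
      A.Eigen x y → ¬ C.IsFree y → (∀ B ∈ Δ, ¬ B.IsFree y) →
      IntDer Γ (.ex x A) → IntDer (insert (A.subst x (.var y)) Δ) C →
      IntDer (Γ ∪ Δ) C
  -- identity; its elimination is for atomic formulas
  | eqI {e : Bool} {Γ : Set (IForm (.free e))} {t : Term} :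
      IntDer Γ (.exist t) → IntDer Γ (.eq t t)
  | eqI' {Γ : Set (IForm .ordinary)} {t : Term} : IntDer Γ (.eq t t)
  | eqE {v : Version} {Γ : Set (IForm v)} {P : IPred v} {ts : Fin P.arity → Term} {x : ℕ}
      {t₁ t₂ : Term} :
      IntDer Γ (.eq t₁ t₂) → IntDer Γ ((IForm.atom P ts).subst x t₁) →
      IntDer Γ ((IForm.atom P ts).subst x t₂)
  -- predicates, free version
  | pd {e : Bool} {Γ : Set (IForm (.free e))} {P : IPred (.free e)} {ts : Fin P.arity → Term}
      (i : Fin P.arity) :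
      P.Denotes → IntDer Γ (.atom P ts) → IntDer Γ (.exist (ts i))

/-- Provability in ordinary first-order N4 with identity. -/
def ProvN4 (A : NForm .ordinary) : Prop := N4Der ∅ A

/-- Provability in negative free N4 with identity (see `Version` for the flag). -/
def ProvN4NF (e : Bool) (A : NForm (.free e)) : Prop := N4Der ∅ A

/-- Provability in ordinary first-order intuitionistic logic with identity. -/
def ProvInt (A : IForm .ordinary) : Prop := IntDer ∅ A

/-- Provability in negative free intuitionistic logic with identity (see `Version` for the
flag). -/
def ProvIntNF (e : Bool) (A : IForm (.free e)) : Prop := IntDer ∅ A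

/-! ### The embedding -/

mutual

/-- The embedding `τ`. -/
def tau {v : Version} : NForm v → IForm v
  | .atom P ts => .atom (.plain P) ts
  | .neg A => tauNeg A
  | .and A B => .and (tau A) (tau B)
  | .or A B => .or (tau A) (tau B)
  | .imp A B => .imp (tau A) (tau B)
  | .all x A => .all x (tau A)
  | .ex x A => .ex x (tau A)

/-- `tauNeg A` is `τ` of the negation of `A`. -/
def tauNeg {v : Version} : NForm v → IForm v
  | .atom P ts => .atom (.primed P) ts
  | .neg A => tau A
  | .and A B => .or (tauNeg A) (tauNeg B)
  | .or A B => .and (tauNeg A) (tauNeg B)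
  | .imp A B => .and (tau A) (tauNeg B)
  | .all x A => .ex x (tauNeg A)
  | .ex x A => .all x (tauNeg A)

end

end Nelson

namespace Nelson

open Filter

variable {v : Version}

/-! ### The embedding and substitution -/

-- From left to right, τ turns each N4 rule into an Int rule. A negated compound goes to the dual
-- compound and a negated atom to a primed atom, so the rules for negated formulas become the
-- ordinary rules for `∧`, `∨`, `∀`, `∃`; this is `N4Der.toInt`.
--
-- The converse cannot be read off an Int derivation directly, since that derivation may pass
-- through `⊥`, which N4 does not express. Instead of normalizing derivations, the proof builds one
-- model of Int out of N4 provability. Its worlds are the sets of N4 assumptions that leave almost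
-- all variables fresh, ordered by inclusion. A plain atom holds at Γ if Γ proves it, and a primed
-- atom holds if Γ proves the negated atom. The individuals are the terms that Γ proves to exist.
-- Disjunction, `∃` and `⊥` are read through their elimination rules: Γ satisfies `Closure X` if
-- every extension of Γ proves every formula that all its own extensions with property `X` prove.
-- Thus `⊥` holds exactly where everything is provable, hereditarily, and `⊥/B` is sound without any
-- explosion in N4.
--
-- `IntDer.sound` shows that Int is sound for this model. The truth lemma
-- `forces_tau_and_tauNeg_iff` shows that τ(A) holds at Γ under the identity assignment iff Γ proves
-- A in N4. Together, at the empty world, they give the converse.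
--
-- The delicate point is the quantifiers. A term `t` need not be free for `x` in `A`, so the truth
-- lemma cannot treat every instance as a substitution. It treats only fresh variables `w`; other
-- terms are reached through the assumption `w = t`, which is harmless by `N4Der.of_fresh_name`, and
-- by replacement of equals in the model, `Forces.congr_eq`.

mutual

theorem tau_subst (x : ℕ) (t : Term) :
    ∀ A : NForm v, tau (A.subst x t) = (tau A).subst x t
  | .atom P ts => rfl
  | .neg A => by simpa only [NForm.subst, tau] using tauNeg_subst x t A
  | .and A B => by simp only [NForm.subst, tau, IForm.subst, tau_subst x t A, tau_subst x t B]
  | .or A B => by simp only [NForm.subst, tau, IForm.subst, tau_subst x t A, tau_subst x t B]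
  | .imp A B => by simp only [NForm.subst, tau, IForm.subst, tau_subst x t A, tau_subst x t B]
  | .all y A => by
      simp only [NForm.subst, tau, IForm.subst, ← tau_subst x t A]; split <;> rfl
  | .ex y A => by
      simp only [NForm.subst, tau, IForm.subst, ← tau_subst x t A]; split <;> rfl

theorem tauNeg_subst (x : ℕ) (t : Term) :
    ∀ A : NForm v, tauNeg (A.subst x t) = (tauNeg A).subst x t
  | .atom P ts => rfl
  | .neg A => by simpa only [NForm.subst, tauNeg] using tau_subst x t A
  | .and A B => by
      simp only [NForm.subst, tauNeg, IForm.subst, tauNeg_subst x t A, tauNeg_subst x t B]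
  | .or A B => by
      simp only [NForm.subst, tauNeg, IForm.subst, tauNeg_subst x t A, tauNeg_subst x t B]
  | .imp A B => by
      simp only [NForm.subst, tauNeg, IForm.subst, tau_subst x t A, tauNeg_subst x t B]
  | .all y A => by
      simp only [NForm.subst, tauNeg, IForm.subst, ← tauNeg_subst x t A]; split <;> rfl
  | .ex y A => by
      simp only [NForm.subst, tauNeg, IForm.subst, ← tauNeg_subst x t A]; split <;> rfl

end

/-- Both halves go in one induction, because a negation exchanges `tau` and `tauNeg`. -/
theorem isFree_tau_and_tauNeg (x : ℕ) (A : NForm v) :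
    ((tau A).IsFree x ↔ A.IsFree x) ∧ ((tauNeg A).IsFree x ↔ A.IsFree x) := by
  induction A <;> simp_all [tau, tauNeg, NForm.IsFree, IForm.IsFree]

theorem isFree_tau (x : ℕ) (A : NForm v) : (tau A).IsFree x ↔ A.IsFree x :=
  (isFree_tau_and_tauNeg x A).1

theorem isFree_tauNeg (x : ℕ) (A : NForm v) : (tauNeg A).IsFree x ↔ A.IsFree x :=
  (isFree_tau_and_tauNeg x A).2

theorem freeFor_tau_and_tauNeg (t : Term) (x : ℕ) (A : NForm v) :
    ((tau A).FreeFor t x ↔ A.FreeFor t x) ∧ ((tauNeg A).FreeFor t x ↔ A.FreeFor t x) := by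
  induction A <;>
    simp_all [tau, tauNeg, NForm.FreeFor, IForm.FreeFor, isFree_tau, isFree_tauNeg]

theorem NForm.FreeFor.tau {t : Term} {x : ℕ} {A : NForm v} (h : A.FreeFor t x) :
    (tau A).FreeFor t x :=
  (freeFor_tau_and_tauNeg t x A).1.2 h

theorem NForm.FreeFor.tauNeg {t : Term} {x : ℕ} {A : NForm v} (h : A.FreeFor t x) :
    (tauNeg A).FreeFor t x :=
  (freeFor_tau_and_tauNeg t x A).2.2 h

theorem NForm.Eigen.tau {x y : ℕ} {A : NForm v} (h : A.Eigen x y) : (tau A).Eigen x y :=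
  ⟨h.1.tau, by simpa only [isFree_tau] using h.2⟩

theorem NForm.Eigen.tauNeg {x y : ℕ} {A : NForm v} (h : A.Eigen x y) : (tauNeg A).Eigen x y :=
  ⟨h.1.tauNeg, by simpa only [isFree_tauNeg] using h.2⟩

theorem tau_image_fresh {Γ : Set (NForm v)} {y : ℕ} (h : ∀ B ∈ Γ, ¬ B.IsFree y) :
    ∀ B ∈ tau '' Γ, ¬ B.IsFree y := by
  rintro _ ⟨B, hB, rfl⟩
  rw [isFree_tau]
  exact h B hB

/-! ### The embedding preserves derivability -/

theorem N4Der.toInt {Γ : Set (NForm v)} {A : NForm v} (h : N4Der Γ A) :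
    IntDer (tau '' Γ) (tau A) := by
  induction h with
  | assumption h => exact .assumption ⟨_, h, rfl⟩
  | weakening h _ ih => exact .weakening (Set.image_mono h) ih
  | orI₁ _ ih => exact .orI₁ ih
  | orI₂ _ ih => exact .orI₂ ih
  | orE _ _ _ ih ih₁ ih₂ =>
      rw [Set.image_insert_eq] at ih₁ ih₂
      exact .orE ih ih₁ ih₂
  | impI _ ih =>
      rw [Set.image_insert_eq] at ih
      exact .impI ih
  | impE _ _ ih₁ ih₂ => exact .impE ih₁ ih₂
  | andI _ _ ih₁ ih₂ => exact .andI ih₁ ih₂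
  | andE₁ _ ih => exact .andE₁ ih
  | andE₂ _ ih => exact .andE₂ ih
  -- τ does not distinguish a formula from its double negation, so premise and conclusion coincide.
  | negNegI _ ih => exact ih
  | negNegE _ ih => exact ih
  | negImpI _ _ ih₁ ih₂ => exact .andI ih₁ ih₂
  | negImpE₁ _ ih => exact .andE₁ ih
  | negImpE₂ _ ih => exact .andE₂ ih
  | negOrI _ _ ih₁ ih₂ => exact .andI ih₁ ih₂
  | negOrE₁ _ ih => exact .andE₁ ih
  | negOrE₂ _ ih => exact .andE₂ ih
  | negAndI₁ _ ih => exact .orI₁ ih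
  | negAndI₂ _ ih => exact .orI₂ ih
  | negAndE _ _ _ ih ih₁ ih₂ =>
      rw [Set.image_insert_eq] at ih₁ ih₂
      exact .orE ih ih₁ ih₂
  | allI hA hΓ _ ih =>
      rw [Set.image_insert_eq, tau_subst] at ih
      exact .allI hA.tau (tau_image_fresh hΓ) ih
  | allE hA _ _ ih₁ ih₂ =>
      rw [tau_subst]
      exact .allE hA.tau ih₁ ih₂
  | negAllI hA _ _ ih₁ ih₂ =>
      rw [tau, tauNeg_subst] at ih₁
      exact .exI hA.tauNeg ih₁ ih₂
  | negAllE hA hC hΔ _ _ ih₁ ih₂ =>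
      rw [Set.image_insert_eq, Set.image_insert_eq, tau, tauNeg_subst] at ih₂
      rw [Set.image_union]
      exact .exE hA.tauNeg (mt (isFree_tau _ _).1 hC) (tau_image_fresh hΔ) ih₁ ih₂
  | exI hA _ _ ih₁ ih₂ =>
      rw [tau_subst] at ih₁
      exact .exI hA.tau ih₁ ih₂
  | exE hA hC hΔ _ _ ih₁ ih₂ =>
      rw [Set.image_insert_eq, Set.image_insert_eq, tau_subst] at ih₂
      rw [Set.image_union]
      exact .exE hA.tau (mt (isFree_tau _ _).1 hC) (tau_image_fresh hΔ) ih₁ ih₂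
  | negExI hA hΓ _ ih =>
      rw [Set.image_insert_eq, tau, tauNeg_subst] at ih
      exact .allI hA.tauNeg (tau_image_fresh hΓ) ih
  | negExE hA _ _ ih₁ ih₂ =>
      rw [tau, tauNeg_subst]
      exact .allE hA.tauNeg ih₁ ih₂
  | allI' hA hΓ _ ih =>
      rw [tau_subst] at ih
      exact .allI' hA.tau (tau_image_fresh hΓ) ih
  | allE' hA _ ih =>
      rw [tau_subst]
      exact .allE' hA.tau ih
  | negAllI' hA _ ih =>
      rw [tau, tauNeg_subst] at ih
      exact .exI' hA.tauNeg ih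
  | negAllE' hA hC hΔ _ _ ih₁ ih₂ =>
      rw [Set.image_insert_eq, tau, tauNeg_subst] at ih₂
      rw [Set.image_union]
      exact .exE' hA.tauNeg (mt (isFree_tau _ _).1 hC) (tau_image_fresh hΔ) ih₁ ih₂
  | exI' hA _ ih =>
      rw [tau_subst] at ih
      exact .exI' hA.tau ih
  | exE' hA hC hΔ _ _ ih₁ ih₂ =>
      rw [Set.image_insert_eq, tau_subst] at ih₂
      rw [Set.image_union]
      exact .exE' hA.tau (mt (isFree_tau _ _).1 hC) (tau_image_fresh hΔ) ih₁ ih₂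
  | negExI' hA hΓ _ ih =>
      rw [tau, tauNeg_subst] at ih
      exact .allI' hA.tauNeg (tau_image_fresh hΓ) ih
  | negExE' hA _ ih =>
      rw [tau, tauNeg_subst]
      exact .allE' hA.tauNeg ih
  | eqI _ ih => exact .eqI ih
  | eqI' => exact .eqI'
  | eqE _ _ ih₁ ih₂ => exact .eqE ih₁ ih₂
  | eqENeg _ _ ih₁ ih₂ =>
      -- Identity elimination for a negated atom is identity elimination for the primed atom.
      exact .eqE (P := .primed _) ih₁ ih₂
  | pd i hP _ ih => exact .pd (P := .plain _) i hP ih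
  | negPd i hP _ ih => exact .pd (P := .primed _) i hP ih

/-! ### Fresh variables -/

theorem Term.subst_of_ne {s : Term} {x : ℕ} (h : s ≠ .var x) (t : Term) : s.subst x t = s := by
  cases s with
  | var y => simp_all [Term.subst]
  | const k => rfl

theorem Term.eventually_ne_var (t : Term) : ∀ᶠ w in atTop, t ≠ .var w := by
  cases t with
  | var x =>
      filter_upwards [eventually_gt_atTop x] with w hw h
      cases h
      exact lt_irrefl _ hw
  | const k => exact .of_forall fun w h => nomatch h

theorem NForm.eventually_not_isFree (A : NForm v) : ∀ᶠ w in atTop, ¬ A.IsFree w := by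
  induction A with
  | atom P ts =>
      filter_upwards [eventually_all.2 fun i => (ts i).eventually_ne_var] with w hw h
      exact h.elim hw
  | neg A ih => exact ih
  | and A B ihA ihB => filter_upwards [ihA, ihB] with w h₁ h₂ h using h.elim h₁ h₂
  | or A B ihA ihB => filter_upwards [ihA, ihB] with w h₁ h₂ h using h.elim h₁ h₂
  | imp A B ihA ihB => filter_upwards [ihA, ihB] with w h₁ h₂ h using h.elim h₁ h₂
  | all x A ih => filter_upwards [ih] with w h₁ h using h₁ h.2
  | ex x A ih => filter_upwards [ih] with w h₁ h using h₁ h.2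

theorem NForm.eventually_freeFor (A : NForm v) (x : ℕ) :
    ∀ᶠ w in atTop, A.FreeFor (.var w) x := by
  induction A with
  | atom P ts => exact .of_forall fun _ => trivial
  | neg A ih => exact ih
  | and A B ihA ihB => exact ihA.and ihB
  | or A B ihA ihB => exact ihA.and ihB
  | imp A B ihA ihB => exact ihA.and ihB
  | all y A ih =>
      filter_upwards [ih, (Term.var y).eventually_ne_var] with w h₁ h₂ _ using ⟨h₂.symm, h₁⟩
  | ex y A ih =>
      filter_upwards [ih, (Term.var y).eventually_ne_var] with w h₁ h₂ _ using ⟨h₂.symm, h₁⟩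

theorem NForm.eventually_eigen (A : NForm v) (x : ℕ) : ∀ᶠ w in atTop, A.Eigen x w := by
  filter_upwards [A.eventually_freeFor x, A.eventually_not_isFree] with w h₁ h₂
    using ⟨h₁, .inr h₂⟩

/-! ### Rules common to the two versions of Nelson's logic -/

/-- `t` is provably existent; a vacuous condition in the ordinary version. -/
def Exists : {v : Version} → Set (NForm v) → Term → Prop
  | .ordinary, _, _ => True
  | .free _, Γ, t => N4Der Γ (.exist t)

/-- The assumption that `t` exists, added in the free version only. -/
def addExists : {v : Version} → Term → Set (NForm v) → Set (NForm v)
  | .ordinary, _, Γ => Γ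
  | .free _, t, Γ => insert (.exist t) Γ

theorem Exists.mono {Γ Δ : Set (NForm v)} {t : Term} (h : Γ ⊆ Δ) (ht : Exists Γ t) :
    Exists Δ t := by
  cases v with
  | ordinary => trivial
  | free e => exact N4Der.weakening h ht

theorem subset_addExists (t : Term) (Γ : Set (NForm v)) : Γ ⊆ addExists t Γ := by
  cases v with
  | ordinary => exact subset_rfl
  | free e => exact Set.subset_insert _ _

theorem exists_addExists (t : Term) (Γ : Set (NForm v)) : Exists (addExists t Γ) t := by
  cases v with
  | ordinary => trivial
  | free e => exact .assumption (Set.mem_insert _ _)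

theorem fresh_addExists {t : Term} {Γ : Set (NForm v)} {w : ℕ} (ht : t ≠ .var w)
    (h : ∀ B ∈ Γ, ¬ B.IsFree w) : ∀ B ∈ addExists t Γ, ¬ B.IsFree w := by
  cases v with
  | ordinary => exact h
  | free e =>
      rintro B (rfl | hB)
      · rintro ⟨i, hi⟩
        fin_cases i
        exact ht hi
      · exact h B hB

namespace N4Der

variable {Γ : Set (NForm v)}

theorem all_intro {A : NForm v} {x y : ℕ} (hA : A.Eigen x y) (hΓ : ∀ B ∈ Γ, ¬ B.IsFree y)
    (h : N4Der (addExists (.var y) Γ) (A.subst x (.var y))) : N4Der Γ (.all x A) := by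
  cases v with
  | ordinary => exact .allI' hA hΓ h
  | free e => exact .allI hA hΓ h

theorem all_elim {A : NForm v} {x : ℕ} {t : Term} (hA : A.FreeFor t x)
    (h : N4Der Γ (.all x A)) (ht : Exists Γ t) : N4Der Γ (A.subst x t) := by
  cases v with
  | ordinary => exact .allE' hA h
  | free e => exact .allE hA h ht

theorem ex_intro {A : NForm v} {x : ℕ} {t : Term} (hA : A.FreeFor t x)
    (h : N4Der Γ (A.subst x t)) (ht : Exists Γ t) : N4Der Γ (.ex x A) := by
  cases v with
  | ordinary => exact .exI' hA h
  | free e => exact .exI hA h ht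

theorem ex_elim {A C : NForm v} {x y : ℕ} (hA : A.Eigen x y) (hC : ¬ C.IsFree y)
    (hΓ : ∀ B ∈ Γ, ¬ B.IsFree y) (h : N4Der Γ (.ex x A))
    (h' : N4Der (insert (A.subst x (.var y)) (addExists (.var y) Γ)) C) : N4Der Γ C := by
  -- The primitive rule keeps the assumptions of its two premises apart; here both sets are Γ.
  rw [← Set.union_self Γ]
  cases v with
  | ordinary => exact .exE' hA hC hΓ h h'
  | free e => exact .exE hA hC hΓ h h'

theorem neg_ex_intro {A : NForm v} {x y : ℕ} (hA : A.Eigen x y) (hΓ : ∀ B ∈ Γ, ¬ B.IsFree y)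
    (h : N4Der (addExists (.var y) Γ) (.neg (A.subst x (.var y)))) :
    N4Der Γ (.neg (.ex x A)) := by
  cases v with
  | ordinary => exact .negExI' hA hΓ h
  | free e => exact .negExI hA hΓ h

theorem neg_ex_elim {A : NForm v} {x : ℕ} {t : Term} (hA : A.FreeFor t x)
    (h : N4Der Γ (.neg (.ex x A))) (ht : Exists Γ t) : N4Der Γ (.neg (A.subst x t)) := by
  cases v with
  | ordinary => exact .negExE' hA h
  | free e => exact .negExE hA h ht

theorem neg_all_intro {A : NForm v} {x : ℕ} {t : Term} (hA : A.FreeFor t x)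
    (h : N4Der Γ (.neg (A.subst x t))) (ht : Exists Γ t) : N4Der Γ (.neg (.all x A)) := by
  cases v with
  | ordinary => exact .negAllI' hA h
  | free e => exact .negAllI hA h ht

theorem neg_all_elim {A C : NForm v} {x y : ℕ} (hA : A.Eigen x y) (hC : ¬ C.IsFree y)
    (hΓ : ∀ B ∈ Γ, ¬ B.IsFree y) (h : N4Der Γ (.neg (.all x A)))
    (h' : N4Der (insert (.neg (A.subst x (.var y))) (addExists (.var y) Γ)) C) :
    N4Der Γ C := by
  rw [← Set.union_self Γ]
  cases v with
  | ordinary => exact .negAllE' hA hC hΓ h h'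
  | free e => exact .negAllE hA hC hΓ h h'

theorem eq_refl {t : Term} (ht : Exists Γ t) : N4Der Γ (.eq t t) := by
  cases v with
  | ordinary => exact .eqI'
  | free e => exact .eqI ht

theorem exists_left {s t : Term} (h : N4Der Γ (.eq s t)) : Exists Γ s := by
  cases v with
  | ordinary => trivial
  | free e =>
      -- Identity is subject to the denotation rules under either value of the flag.
      have hP : (Pred.eq : Pred (.free e)).Denotes := trivial
      let ts : Fin (Pred.eq : Pred (.free e)).arity → Term := ![s, t]
      exact N4Der.pd (ts := ts) 0 hP h

end N4Der

/-- The formula of Nelson's logic that an atom of the extended intuitionistic language stands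
for. -/
def IPred.literal : (P : IPred v) → (Fin P.arity → Term) → NForm v
  | .plain P, ts => .atom P ts
  | .primed P, ts => .neg (.atom P ts)

-- Replacement of equals in literals, and fresh names for existing terms.

theorem N4Der.literal_congr {Γ : Set (NForm v)} {P : IPred v} {ss ss' : Fin P.arity → Term}
    {t₁ t₂ : Term} (hs : ∀ i, ss i = ss' i ∨ ss i = t₁ ∧ ss' i = t₂)
    (ht : N4Der Γ (.eq t₁ t₂)) (h : N4Der Γ (P.literal ss)) : N4Der Γ (P.literal ss') := by
  classical
  -- A variable `x` absent from `ss` marks the places to be changed; then one identity elimination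
  -- on the marked literal replaces them all simultaneously.
  obtain ⟨x, hx⟩ := (eventually_all.2 fun i => (ss i).eventually_ne_var).exists
  let us : Fin P.arity → Term := fun i => if ss i = ss' i then ss i else .var x
  have h₁ : (fun i => (us i).subst x t₁) = ss := by
    funext i
    by_cases hi : ss i = ss' i
    · simp only [us, if_pos hi, Term.subst_of_ne (hx i)]
    · simp only [us, if_neg hi, Term.subst, if_true, (hs i).resolve_left hi]
  have h₂ : (fun i => (us i).subst x t₂) = ss' := by
    funext i
    by_cases hi : ss i = ss' i
    · simp only [us, if_pos hi]
      rw [Term.subst_of_ne (hx i), hi]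
    · simp only [us, if_neg hi, Term.subst, if_true, (hs i).resolve_left hi]
  rw [← h₁] at h
  rw [← h₂]
  cases P with
  | plain P => exact .eqE ht h
  | primed P => exact .eqENeg ht h

theorem N4Der.eq_symm {Γ : Set (NForm v)} {s t : Term} (h : N4Der Γ (.eq s t)) :
    N4Der Γ (.eq t s) := by
  let ss (r : Term) : Fin (IPred.plain (Pred.eq : Pred v)).arity → Term := ![r, s]
  -- Symmetry comes from `s = s` by replacing only the left-hand `s`.
  have hs : N4Der Γ ((IPred.plain Pred.eq).literal (ss s)) := N4Der.eq_refl h.exists_left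
  refine N4Der.literal_congr (ss' := ss t) ?_ h hs
  intro i
  fin_cases i
  · exact .inr ⟨rfl, rfl⟩
  · exact .inl rfl

/-- An existing term may be assumed to be equal to a fresh variable. -/
theorem N4Der.of_fresh_name {Γ : Set (NForm v)} {t : Term} {C : NForm v} {w : ℕ}
    (ht : Exists Γ t) (htw : t ≠ .var w) (hC : ¬ C.IsFree w) (hΓ : ∀ B ∈ Γ, ¬ B.IsFree w)
    (h : N4Der (insert (.eq (.var w) t) Γ) C) : N4Der Γ C := by
  have subst_eq (s : Term) : (NForm.eq (.var w) t : NForm v).subst w s = .eq s t := by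
    simp only [NForm.eq, NForm.subst, NForm.atom.injEq, heq_eq_eq, true_and]
    funext i
    fin_cases i
    · simp [Term.subst]
    · exact Term.subst_of_ne htw s
  -- Since `t` exists, `∃w (w = t)` is provable with witness `t`; eliminating it with eigenvariable
  -- `w` discharges the equation.
  refine N4Der.ex_elim (A := .eq (.var w) t) (x := w) (y := w) ⟨trivial, .inl rfl⟩ hC hΓ ?_ ?_
  · refine N4Der.ex_intro (t := t) trivial ?_ ht
    rw [subst_eq]
    exact N4Der.eq_refl ht
  · rw [subst_eq]
    exact .weakening (Set.insert_subset_insert (subset_addExists _ _)) h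

/-! ### A semantics of sets of assumptions -/

/-- Sets of assumptions that leave all but finitely many variables fresh. -/
abbrev World (v : Version) : Type :=
  {Γ : Set (NForm v) // ∀ᶠ w in atTop, ∀ B ∈ Γ, ¬ B.IsFree w}

/-- The world `Γ` with the assumption `A` added. -/
def World.insert (A : NForm v) (Γ : World v) : World v :=
  ⟨Insert.insert A Γ.1, by
    filter_upwards [Γ.2, A.eventually_not_isFree] with w h₁ h₂
    rintro B (rfl | hB)
    exacts [h₂, h₁ B hB]⟩

/-- The world `Γ` with the assumption, in the free version, that `t` exists. -/
def World.addExists (t : Term) (Γ : World v) : World v :=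
  ⟨Nelson.addExists t Γ.1, by
    filter_upwards [Γ.2, t.eventually_ne_var] with w h₁ h₂ using fresh_addExists h₂ h₁⟩

theorem World.le_insert (A : NForm v) (Γ : World v) : Γ ≤ Γ.insert A :=
  Set.subset_insert _ _

theorem World.le_addExists (t : Term) (Γ : World v) : Γ ≤ Γ.addExists t :=
  subset_addExists _ _

theorem World.insert_le_insert (A : NForm v) {Γ Δ : World v} (h : Γ ≤ Δ) :
    Γ.insert A ≤ Δ.insert A :=
  Set.insert_subset_insert h

/-- The worlds that prove every formula provable in all their extensions with property `X`. -/
def Closure (X : World v → Prop) (Γ : World v) : Prop :=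
  ∀ Δ ≥ Γ, ∀ C, (∀ Θ ≥ Δ, X Θ → N4Der Θ.1 C) → N4Der Δ.1 C

/-- With `map` and `idem`, this makes `Closure` a closure operator on the upward closed properties
of worlds. By `Closure.der` the provability of a fixed formula is a closed property. -/
theorem Closure.of_mem {X : World v → Prop} (hX : ∀ Γ Δ : World v, Γ ≤ Δ → X Γ → X Δ)
    {Γ : World v} (h : X Γ) : Closure X Γ :=
  fun Δ hΔ _ hC => hC Δ le_rfl (hX _ _ hΔ h)

theorem Closure.mono {X : World v → Prop} {Γ Δ : World v} (h : Γ ≤ Δ) (hX : Closure X Γ) :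
    Closure X Δ :=
  fun Θ hΘ => hX Θ (h.trans hΘ)

theorem Closure.map {X Y : World v → Prop} {Γ : World v} (h : ∀ Δ ≥ Γ, X Δ → Y Δ)
    (hX : Closure X Γ) : Closure Y Γ :=
  fun Δ hΔ C hC => hX Δ hΔ C fun Θ hΘ hXΘ => hC Θ hΘ (h Θ (hΔ.trans hΘ) hXΘ)

theorem Closure.idem {X : World v → Prop} {Γ : World v} (h : Closure (Closure X) Γ) :
    Closure X Γ :=
  fun Δ hΔ C hC => h Δ hΔ C fun Θ hΘ hX => hX Θ le_rfl C fun Ξ hΞ => hC Ξ (hΘ.trans hΞ)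

theorem Closure.der {A : NForm v} {Γ : World v} (h : Closure (fun Δ => N4Der Δ.1 A) Γ) :
    N4Der Γ.1 A :=
  h Γ le_rfl A fun _ _ h => h

/-- The value of a term under an assignment of terms to the variables. -/
def Term.eval (ρ : ℕ → Term) : Term → Term
  | .var x => ρ x
  | .const k => .const k

/-- `Forces A ρ Γ`: the formula `A` holds at the world `Γ` under the assignment `ρ`. -/
def Forces : IForm v → (ℕ → Term) → World v → Prop
  | .atom P ts, ρ, Γ => N4Der Γ.1 (P.literal fun i => (ts i).eval ρ)
  | .bot, _, Γ => Closure (fun _ => False) Γ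
  | .and A B, ρ, Γ => Forces A ρ Γ ∧ Forces B ρ Γ
  | .or A B, ρ, Γ => Closure (fun Δ => Forces A ρ Δ ∨ Forces B ρ Δ) Γ
  | .imp A B, ρ, Γ => ∀ Δ ≥ Γ, Forces A ρ Δ → Forces B ρ Δ
  | .all x A, ρ, Γ => ∀ Δ ≥ Γ, ∀ t, Exists Δ.1 t → Forces A (Function.update ρ x t) Δ
  | .ex x A, ρ, Γ =>
      Closure (fun Δ => ∃ t, Exists Δ.1 t ∧ Forces A (Function.update ρ x t) Δ) Γ

theorem Forces.mono {A : IForm v} {ρ : ℕ → Term} {Γ Δ : World v} (h : Γ ≤ Δ)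
    (hA : Forces A ρ Γ) : Forces A ρ Δ := by
  induction A generalizing ρ with
  | atom P ts => exact .weakening h hA
  | bot => exact Closure.mono h hA
  | and A B ihA ihB => exact ⟨ihA hA.1, ihB hA.2⟩
  | or A B _ _ => exact Closure.mono h hA
  | imp A B _ _ => exact fun Θ hΘ => hA Θ (h.trans hΘ)
  | all x A _ => exact fun Θ hΘ => hA Θ (h.trans hΘ)
  | ex x A _ => exact Closure.mono h hA

/-- Truth of any formula is a closed property: atoms by `Closure.der`, the clauses for `⊥`, `∨`, `∃`
by idempotence, and the others because their components are closed. This is what makes the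
eliminations of `∨`, `∃` and `⊥` sound for arbitrary conclusions. -/
theorem Forces.of_closure {A : IForm v} {ρ : ℕ → Term} {Γ : World v}
    (hA : Closure (Forces A ρ) Γ) : Forces A ρ Γ := by
  induction A generalizing ρ Γ with
  | atom P ts => exact hA.der
  | bot => exact Closure.idem hA
  | and A B ihA ihB =>
      exact ⟨ihA (hA.map fun _ _ h => h.1), ihB (hA.map fun _ _ h => h.2)⟩
  | or A B _ _ => exact Closure.idem hA
  | imp A B _ ihB =>
      exact fun Δ hΔ h => ihB <| (hA.mono hΔ).map fun Θ hΘ h' => h' Θ le_rfl (h.mono hΘ)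
  | all x A ih =>
      exact fun Δ hΔ t ht =>
        ih <| (hA.mono hΔ).map fun Θ hΘ h' => h' Θ le_rfl t (ht.mono hΘ)
  | ex x A _ => exact Closure.idem hA

-- Forcing under change of assignment, substitution and replacement of equals.

theorem forces_congr {A : IForm v} {ρ ρ' : ℕ → Term} {Γ : World v}
    (h : ∀ x, A.IsFree x → ρ x = ρ' x) : Forces A ρ Γ ↔ Forces A ρ' Γ := by
  induction A generalizing ρ ρ' Γ with
  | atom P ts =>
      have : (fun i => (ts i).eval ρ) = fun i => (ts i).eval ρ' := by
        funext i
        cases hi : ts i with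
        | var x => exact h x ⟨i, hi⟩
        | const k => rfl
      simp only [Forces, this]
  | bot => exact Iff.rfl
  | and A B ihA ihB =>
      exact and_congr (ihA fun x hx => h x (.inl hx)) (ihB fun x hx => h x (.inr hx))
  | or A B ihA ihB =>
      simp only [Forces, ihA fun x hx => h x (.inl hx), ihB fun x hx => h x (.inr hx)]
  | imp A B ihA ihB =>
      simp only [Forces, ihA fun x hx => h x (.inl hx), ihB fun x hx => h x (.inr hx)]
  | all y A ih =>
      have (t : Term) (Δ : World v) :
          Forces A (Function.update ρ y t) Δ ↔ Forces A (Function.update ρ' y t) Δ := by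
        refine ih fun x hx => ?_
        by_cases hxy : x = y
        · simp [hxy]
        · simpa [hxy] using h x ⟨Ne.symm hxy, hx⟩
      simp only [Forces, this]
  | ex y A ih =>
      have (t : Term) (Δ : World v) :
          Forces A (Function.update ρ y t) Δ ↔ Forces A (Function.update ρ' y t) Δ := by
        refine ih fun x hx => ?_
        by_cases hxy : x = y
        · simp [hxy]
        · simpa [hxy] using h x ⟨Ne.symm hxy, hx⟩
      simp only [Forces, this]

theorem IForm.subst_of_not_isFree {A : IForm v} {x : ℕ} (h : ¬ A.IsFree x) (t : Term) :
    A.subst x t = A := by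
  induction A with
  | atom P ts =>
      simp only [IForm.subst, IForm.atom.injEq, heq_eq_eq, true_and]
      exact funext fun i => Term.subst_of_ne (fun hi => h ⟨i, hi⟩) t
  | bot => rfl
  | and A B ihA ihB => rw [IForm.subst, ihA (mt .inl h), ihB (mt .inr h)]
  | or A B ihA ihB => rw [IForm.subst, ihA (mt .inl h), ihB (mt .inr h)]
  | imp A B ihA ihB => rw [IForm.subst, ihA (mt .inl h), ihB (mt .inr h)]
  | all y A ih =>
      rw [IForm.subst]
      split
      · rfl
      · rw [ih fun hA => h ⟨‹_›, hA⟩]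
  | ex y A ih =>
      rw [IForm.subst]
      split
      · rfl
      · rw [ih fun hA => h ⟨‹_›, hA⟩]

theorem Term.eval_subst (ρ : ℕ → Term) (s t : Term) (x : ℕ) :
    (s.subst x t).eval ρ = s.eval (Function.update ρ x (t.eval ρ)) := by
  cases s with
  | var y =>
      by_cases h : y = x
      · simp [Term.subst, Term.eval, h]
      · simp [Term.subst, Term.eval, h]
  | const k => rfl

theorem Term.eval_update_of_ne {ρ : ℕ → Term} {t : Term} {y : ℕ} (h : t ≠ .var y) (d : Term) :
    t.eval (Function.update ρ y d) = t.eval ρ := by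
  cases t with
  | var x =>
      have : x ≠ y := fun hx => h (hx ▸ rfl)
      simp [Term.eval, this]
  | const k => rfl

theorem forces_subst {A : IForm v} {x : ℕ} {t : Term} {ρ : ℕ → Term} {Γ : World v}
    (h : A.FreeFor t x) :
    Forces (A.subst x t) ρ Γ ↔ Forces A (Function.update ρ x (t.eval ρ)) Γ := by
  have key (y : ℕ) (A : IForm v)
      (ih : ∀ {ρ : ℕ → Term} {Γ : World v}, A.FreeFor t x →
        (Forces (A.subst x t) ρ Γ ↔ Forces A (Function.update ρ x (t.eval ρ)) Γ))
      (h : y ≠ x ∧ A.IsFree x → t ≠ .var y ∧ A.FreeFor t x) (ρ : ℕ → Term) (d : Term)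
      (Δ : World v) :
      Forces (if y = x then A else A.subst x t) (Function.update ρ y d) Δ ↔
        Forces A (Function.update (Function.update ρ x (t.eval ρ)) y d) Δ := by
    split
    · rename_i hyx
      rw [hyx, Function.update_idem]
    · rename_i hyx
      by_cases hx : A.IsFree x
      · obtain ⟨h₁, h₂⟩ := h ⟨hyx, hx⟩
        rw [ih h₂, Term.eval_update_of_ne h₁, Function.update_comm hyx]
      -- If `x` is not free in the scope, being free for `x` says nothing about capture, but the
      -- substitution changes nothing either.
      · rw [IForm.subst_of_not_isFree hx]
        refine forces_congr fun z hz => ?_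
        have hzx : z ≠ x := fun hzx => hx (hzx ▸ hz)
        by_cases hzy : z = y
        · simp [hzy]
        · simp [hzy, hzx]
  induction A generalizing ρ Γ with
  | atom P ts => simp only [IForm.subst, Forces, Term.eval_subst]
  | bot => exact Iff.rfl
  | and A B ihA ihB => exact and_congr (ihA h.1) (ihB h.2)
  | or A B ihA ihB => simp only [IForm.subst, Forces, ihA h.1, ihB h.2]
  | imp A B ihA ihB => simp only [IForm.subst, Forces, ihA h.1, ihB h.2]
  | all y A ih => simp only [IForm.subst, Forces, key y A ih h]
  | ex y A ih => simp only [IForm.subst, Forces, key y A ih h]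

theorem Forces.congr_eq {A : IForm v} {ρ ρ' : ℕ → Term} {t₁ t₂ : Term} {Γ : World v}
    (hρ : ∀ x, ρ x = ρ' x ∨ ρ x = t₁ ∧ ρ' x = t₂) (ht : N4Der Γ.1 (.eq t₁ t₂))
    (h : Forces A ρ Γ) : Forces A ρ' Γ := by
  have upd {ρ ρ' : ℕ → Term} {t₁ t₂ : Term} (hρ : ∀ x, ρ x = ρ' x ∨ ρ x = t₁ ∧ ρ' x = t₂)
      (y : ℕ) (d : Term) (x : ℕ) :
      Function.update ρ y d x = Function.update ρ' y d x ∨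
        Function.update ρ y d x = t₁ ∧ Function.update ρ' y d x = t₂ := by
    by_cases hxy : x = y
    · simp [hxy]
    · simpa [hxy] using hρ x
  induction A generalizing ρ ρ' t₁ t₂ Γ with
  | atom P ts =>
      refine N4Der.literal_congr (fun i => ?_) ht h
      cases ts i with
      | var x => exact hρ x
      | const k => exact .inl rfl
  | bot => exact h
  | and A B ihA ihB => exact ⟨ihA hρ ht h.1, ihB hρ ht h.2⟩
  | or A B ihA ihB =>
      exact Closure.map (fun Δ hΔ => Or.imp (ihA hρ (.weakening hΔ ht))
        (ihB hρ (.weakening hΔ ht))) h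
  | imp A B ihA ihB =>
      intro Δ hΔ hA
      have ht' : N4Der Δ.1 (.eq t₁ t₂) := .weakening hΔ ht
      -- The antecedent must be carried back from `ρ'` to `ρ`, hence the reversed equation.
      refine ihB hρ ht' (h Δ hΔ (ihA (fun x => ?_) ht'.eq_symm hA))
      exact (hρ x).imp Eq.symm And.symm
  | all y A ih =>
      exact fun Δ hΔ d hd => ih (upd hρ y d) (.weakening hΔ ht) (h Δ hΔ d hd)
  | ex y A ih =>
      refine Closure.map (fun Δ hΔ => ?_) h
      rintro ⟨d, hd, hA⟩
      exact ⟨d, hd, ih (upd hρ y d) (.weakening hΔ ht) hA⟩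

theorem Forces.update_of_eq {A : IForm v} {ρ : ℕ → Term} {x : ℕ} {t₁ t₂ : Term} {Γ : World v}
    (ht : N4Der Γ.1 (.eq t₁ t₂)) (h : Forces A (Function.update ρ x t₁) Γ) :
    Forces A (Function.update ρ x t₂) Γ := by
  refine h.congr_eq (fun y => ?_) ht
  by_cases hy : y = x
  · exact .inr (by simp [hy])
  · exact .inl (by simp [hy])

/-- The semantic form of `N4Der.of_fresh_name`. The name `w` must be fresh for the formula `C` and
the extension that `Closure` quantifies over, so `X` is required for all large `w`. -/
theorem Closure.of_fresh_name {X : World v → Prop} (hX : ∀ Γ Δ : World v, Γ ≤ Δ → X Γ → X Δ)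
    {Γ : World v} {t : Term} (ht : Exists Γ.1 t)
    (h : ∀ᶠ w in atTop, X (Γ.insert (.eq (.var w) t))) : Closure X Γ := by
  intro Δ hΔ C hC
  obtain ⟨w, hw, hwt, hwC, hwΔ⟩ :=
    (h.and <| t.eventually_ne_var.and <| C.eventually_not_isFree.and Δ.2).exists
  exact N4Der.of_fresh_name (ht.mono hΔ) hwt hwC hwΔ
    (hC _ (Δ.le_insert _) (hX _ _ (World.insert_le_insert _ hΔ) hw))

/-! ### Soundness of intuitionistic logic -/

theorem Forces.of_bot {A : IForm v} {ρ : ℕ → Term} {Γ : World v} (h : Forces .bot ρ Γ) :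
    Forces A ρ Γ :=
  .of_closure (Closure.map (fun _ _ h => h.elim) h)

theorem Term.eval_comp_pair (ρ : ℕ → Term) (s t : Term) :
    (fun i => (![s, t] i).eval ρ) = ![s.eval ρ, t.eval ρ] := by
  funext i
  fin_cases i <;> rfl

theorem forces_eq {ρ : ℕ → Term} {s t : Term} {Γ : World v} :
    Forces (.eq s t) ρ Γ ↔ N4Der Γ.1 (.eq (s.eval ρ) (t.eval ρ)) := by
  have := Term.eval_comp_pair ρ s t
  simp only [IForm.eq, Forces, IPred.literal, NForm.eq]
  exact iff_of_eq (congrArg (fun ts => N4Der Γ.1 (NForm.atom Pred.eq ts)) this)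

theorem forces_exist {e : Bool} {ρ : ℕ → Term} {t : Term} {Γ : World (.free e)} :
    Forces (.exist t) ρ Γ ↔ N4Der Γ.1 (.exist (t.eval ρ)) := by
  have : (fun i => (![t] i).eval ρ) = ![t.eval ρ] := by
    funext i
    fin_cases i
    rfl
  simp only [IForm.exist, Forces, IPred.literal, NForm.exist]
  exact iff_of_eq (congrArg (fun ts => N4Der Γ.1 (NForm.atom Pred.exist ts)) this)

theorem forces_update_of_not_isFree {A : IForm v} {ρ : ℕ → Term} {y : ℕ} {t : Term}
    {Γ : World v} (h : ¬ A.IsFree y) :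
    Forces A (Function.update ρ y t) Γ ↔ Forces A ρ Γ := by
  refine forces_congr fun x hx => ?_
  have : x ≠ y := fun hxy => h (hxy ▸ hx)
  simp [this]

theorem IForm.Eigen.forces_subst {A : IForm v} {x y : ℕ} (h : A.Eigen x y) {ρ : ℕ → Term}
    {t : Term} {Γ : World v} :
    Forces (A.subst x (.var y)) (Function.update ρ y t) Γ ↔
      Forces A (Function.update ρ x t) Γ := by
  rw [Nelson.forces_subst h.1]
  refine forces_congr fun z hz => ?_
  by_cases hzx : z = x
  · simp [hzx, Term.eval]
  · have hzy : z ≠ y := by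
      rintro rfl
      exact h.2.elim hzx (· hz)
    simp [hzx, hzy]

/-- Induction for all assignments at once: an eigenvariable is handled by reassigning it to the
individual in question, so it need not be fresh for the world. -/
theorem IntDer.sound {Γ : Set (IForm v)} {A : IForm v} (h : IntDer Γ A) (ρ : ℕ → Term)
    (Δ : World v) (hΔ : ∀ B ∈ Γ, Forces B ρ Δ) : Forces A ρ Δ := by
  have ins {v : Version} {Γ : Set (IForm v)} {A : IForm v} {ρ : ℕ → Term} {Δ Θ : World v}
      (hΔ : ∀ B ∈ Γ, Forces B ρ Δ) (h : Δ ≤ Θ) (hA : Forces A ρ Θ) :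
      ∀ B ∈ insert A Γ, Forces B ρ Θ := by
    rintro B (rfl | hB)
    exacts [hA, (hΔ B hB).mono h]
  have upd {v : Version} {Γ : Set (IForm v)} {ρ : ℕ → Term} {Δ : World v}
      (hΔ : ∀ B ∈ Γ, Forces B ρ Δ) {y : ℕ} (hy : ∀ B ∈ Γ, ¬ B.IsFree y) (t : Term) :
      ∀ B ∈ Γ, Forces B (Function.update ρ y t) Δ :=
    fun B hB => (forces_update_of_not_isFree (hy B hB)).2 (hΔ B hB)
  induction h generalizing ρ with
  | assumption h => exact hΔ _ h
  | weakening h _ ih => exact ih ρ Δ fun B hB => hΔ B (h hB)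
  | botE _ ih => exact (ih ρ Δ hΔ).of_bot
  | orI₁ _ ih =>
      exact Closure.of_mem (fun _ _ h => Or.imp (.mono h) (.mono h)) (.inl (ih ρ Δ hΔ))
  | orI₂ _ ih =>
      exact Closure.of_mem (fun _ _ h => Or.imp (.mono h) (.mono h)) (.inr (ih ρ Δ hΔ))
  | orE _ _ _ ih ih₁ ih₂ =>
      refine .of_closure (Closure.map (fun Θ hΘ h => ?_) (ih ρ Δ hΔ))
      exact h.elim (fun h => ih₁ ρ Θ (ins hΔ hΘ h)) (fun h => ih₂ ρ Θ (ins hΔ hΘ h))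
  | impI _ ih => exact fun Θ hΘ h => ih ρ Θ (ins hΔ hΘ h)
  | impE _ _ ih₁ ih₂ => exact ih₁ ρ Δ hΔ Δ le_rfl (ih₂ ρ Δ hΔ)
  | andI _ _ ih₁ ih₂ => exact ⟨ih₁ ρ Δ hΔ, ih₂ ρ Δ hΔ⟩
  | andE₁ _ ih => exact (ih ρ Δ hΔ).1
  | andE₂ _ ih => exact (ih ρ Δ hΔ).2
  | @allI e Γ A x y hA hy _ ih =>
      intro Θ hΘ t ht
      refine hA.forces_subst.1 (ih _ Θ (ins (upd hΔ hy t) hΘ (forces_exist.2 ?_)))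
      simpa [Term.eval, Exists] using ht
  | allE hA _ _ ih₁ ih₂ =>
      exact (forces_subst hA).2 (ih₁ ρ Δ hΔ Δ le_rfl _ (forces_exist.1 (ih₂ ρ Δ hΔ)))
  | exI hA _ _ ih₁ ih₂ =>
      refine Closure.of_mem ?_
        ⟨_, forces_exist.1 (ih₂ ρ Δ hΔ), (forces_subst hA).1 (ih₁ ρ Δ hΔ)⟩
      rintro Θ Ξ h ⟨t, ht, h'⟩
      exact ⟨t, ht.mono h, h'.mono h⟩
  | exE hA hC hy _ _ ih₁ ih₂ =>
      refine .of_closure (Closure.map ?_ (ih₁ ρ Δ fun B hB => hΔ B (.inl hB)))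
      rintro Θ hΘ ⟨t, ht, h⟩
      refine (forces_update_of_not_isFree hC).1 (ih₂ _ Θ (ins (ins
        (upd (fun B hB => hΔ B (.inr hB)) hy t) hΘ (forces_exist.2 ?_)) le_rfl
        (hA.forces_subst.2 h)))
      simpa [Term.eval, Exists] using ht
  | allI' hA hy _ ih =>
      exact fun Θ hΘ t _ => hA.forces_subst.1 (ih _ Θ fun B hB => (upd hΔ hy t B hB).mono hΘ)
  | allE' hA _ ih => exact (forces_subst hA).2 (ih ρ Δ hΔ Δ le_rfl _ trivial)
  | exI' hA _ ih =>
      refine Closure.of_mem ?_ ⟨_, trivial, (forces_subst hA).1 (ih ρ Δ hΔ)⟩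
      rintro Θ Ξ h ⟨t, ht, h'⟩
      exact ⟨t, ht.mono h, h'.mono h⟩
  | exE' hA hC hy _ _ ih₁ ih₂ =>
      refine .of_closure (Closure.map ?_ (ih₁ ρ Δ fun B hB => hΔ B (.inl hB)))
      rintro Θ hΘ ⟨t, -, h⟩
      exact (forces_update_of_not_isFree hC).1 (ih₂ _ Θ (ins
        (upd (fun B hB => hΔ B (.inr hB)) hy t) hΘ (hA.forces_subst.2 h)))
  | eqI _ ih => exact forces_eq.2 (.eq_refl (forces_exist.1 (ih ρ Δ hΔ)))
  | eqI' => exact forces_eq.2 .eqI'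
  | @eqE v Γ P ts x t₁ t₂ _ _ ih₁ ih₂ =>
      have free (t : Term) : (IForm.atom P ts).FreeFor t x := trivial
      exact (forces_subst (free t₂)).2 (((forces_subst (free t₁)).1
        (ih₂ ρ Δ hΔ)).update_of_eq (forces_eq.1 (ih₁ ρ Δ hΔ)))
  | @pd e Γ P ts i hP _ ih =>
      have h := ih ρ Δ hΔ
      refine forces_exist.2 ?_
      cases P with
      | plain P => exact .pd i hP h
      | primed P => exact .negPd i hP h

/-! ### Forcing and derivability agree on embedded formulas -/

/-- The number of connectives and quantifiers of a formula, plus one for each atom. -/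
def NForm.size : NForm v → ℕ
  | .atom _ _ => 1
  | .neg A => A.size + 1
  | .and A B => A.size + B.size + 1
  | .or A B => A.size + B.size + 1
  | .imp A B => A.size + B.size + 1
  | .all _ A => A.size + 1
  | .ex _ A => A.size + 1

theorem NForm.size_subst (A : NForm v) (x : ℕ) (t : Term) : (A.subst x t).size = A.size := by
  induction A with
  | all y A ih =>
      rw [NForm.subst]
      split <;> simp_all [NForm.size]
  | ex y A ih =>
      rw [NForm.subst]
      split <;> simp_all [NForm.size]
  | _ => simp_all [NForm.subst, NForm.size]

/-- `D` is any formula with the rules of a disjunction of `A` and `B`, so one argument covers both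
`A ∨ B` and negated conjunctions. The next lemmas on `∀` and `∃` likewise cover `¬∃` and `¬∀`. -/
theorem forces_or_iff {φ ψ : IForm v} {ρ : ℕ → Term} {A B D : NForm v}
    (hφ : ∀ Γ, Forces φ ρ Γ ↔ N4Der Γ.1 A) (hψ : ∀ Γ, Forces ψ ρ Γ ↔ N4Der Γ.1 B)
    (intro₁ : ∀ {Γ}, N4Der Γ A → N4Der Γ D) (intro₂ : ∀ {Γ}, N4Der Γ B → N4Der Γ D)
    (elim : ∀ {Γ C}, N4Der Γ D → N4Der (insert A Γ) C → N4Der (insert B Γ) C → N4Der Γ C)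
    (Γ : World v) : Forces (.or φ ψ) ρ Γ ↔ N4Der Γ.1 D := by
  simp only [Forces, hφ, hψ]
  refine ⟨fun h => (h.map fun _ _ h => h.elim intro₁ intro₂).der, fun h Δ hΔ C hC => ?_⟩
  -- The closure condition is met by the elimination rule itself, applied with the two worlds that
  -- add one disjunct.
  refine elim (.weakening hΔ h) (hC (Δ.insert A) (Δ.le_insert A) (.inl ?_))
    (hC (Δ.insert B) (Δ.le_insert B) (.inr ?_)) <;> exact .assumption (Set.mem_insert _ _)

theorem forces_imp_iff {φ ψ : IForm v} {ρ : ℕ → Term} {A B : NForm v}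
    (hφ : ∀ Γ, Forces φ ρ Γ ↔ N4Der Γ.1 A) (hψ : ∀ Γ, Forces ψ ρ Γ ↔ N4Der Γ.1 B)
    (Γ : World v) : Forces (.imp φ ψ) ρ Γ ↔ N4Der Γ.1 (.imp A B) := by
  simp only [Forces, hφ, hψ]
  exact ⟨fun h => .impI (h (Γ.insert A) (Γ.le_insert A) (.assumption (Set.mem_insert _ _))),
    fun h Δ hΔ => .impE (.weakening hΔ h)⟩

theorem forces_all_iff {φ : IForm v} {x : ℕ} {ρ : ℕ → Term} {D : NForm v} {B : ℕ → NForm v}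
    (hφ : ∀ᶠ w in atTop, ∀ Γ, Forces φ (Function.update ρ x (.var w)) Γ ↔ N4Der Γ.1 (B w))
    (intro_ : ∀ᶠ w in atTop, ∀ Γ, (∀ C ∈ Γ, ¬ C.IsFree w) →
      N4Der (addExists (.var w) Γ) (B w) → N4Der Γ D)
    (elim : ∀ᶠ w in atTop, ∀ Γ, N4Der Γ D → Exists Γ (.var w) → N4Der Γ (B w))
    (Γ : World v) : Forces (.all x φ) ρ Γ ↔ N4Der Γ.1 D := by
  constructor
  · intro h
    obtain ⟨w, h₁, h₂, h₃⟩ := (hφ.and (intro_.and Γ.2)).exists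
    exact h₂ _ h₃ ((h₁ (Γ.addExists (.var w))).1
      (h _ (Γ.le_addExists _) _ (exists_addExists _ _)))
  · intro h Δ hΔ t ht
    -- An arbitrary existing `t` is named by a fresh `w`; the instance at `w` is provable, hence
    -- forced, and is carried over to `t` along `w = t`.
    refine .of_closure (Closure.of_fresh_name (fun _ _ => Forces.mono) ht ?_)
    filter_upwards [hφ, elim] with w h₁ h₂
    have heq : N4Der (Δ.insert (.eq (.var w) t)).1 (.eq (.var w) t) :=
      .assumption (Set.mem_insert _ _)
    exact ((h₁ _).2 (h₂ _ (.weakening (hΔ.trans (Δ.le_insert _)) h)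
      heq.exists_left)).update_of_eq heq

theorem forces_ex_iff {φ : IForm v} {x : ℕ} {ρ : ℕ → Term} {D : NForm v} {B : ℕ → NForm v}
    (hφ : ∀ᶠ w in atTop, ∀ Γ, Forces φ (Function.update ρ x (.var w)) Γ ↔ N4Der Γ.1 (B w))
    (intro_ : ∀ᶠ w in atTop, ∀ Γ, N4Der Γ (B w) → Exists Γ (.var w) → N4Der Γ D)
    (elim : ∀ᶠ w in atTop, ∀ Γ C, (∀ C ∈ Γ, ¬ C.IsFree w) → ¬ C.IsFree w → N4Der Γ D →
      N4Der (insert (B w) (addExists (.var w) Γ)) C → N4Der Γ C)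
    (Γ : World v) : Forces (.ex x φ) ρ Γ ↔ N4Der Γ.1 D := by
  constructor
  · intro h
    refine (Closure.map ?_ h).der
    rintro Δ - ⟨t, ht, hA⟩
    refine (Closure.of_fresh_name (fun _ _ => N4Der.weakening) ht ?_).der
    filter_upwards [hφ, intro_] with w h₁ h₂
    have heq : N4Der (Δ.insert (.eq (.var w) t)).1 (.eq (.var w) t) :=
      .assumption (Set.mem_insert _ _)
    exact h₂ _ ((h₁ _).1 ((hA.mono (Δ.le_insert _)).update_of_eq heq.eq_symm)) heq.exists_left
  · intro h Δ hΔ C hC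
    obtain ⟨w, h₁, h₂, h₃, h₄⟩ :=
      (hφ.and (elim.and (Δ.2.and C.eventually_not_isFree))).exists
    refine h₂ _ C h₃ h₄ (.weakening hΔ h) (hC ((Δ.addExists (.var w)).insert (B w))
      ((Δ.le_addExists _).trans (World.le_insert _ _)) ⟨.var w, ?_, (h₁ _).2 ?_⟩)
    · exact (exists_addExists _ _).mono (Set.subset_insert _ _)
    · exact .assumption (Set.mem_insert _ _)

theorem Term.eval_var (t : Term) : t.eval .var = t := by
  cases t <;> rfl

theorem forces_tau_and_tauNeg_iff (A : NForm v) :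
    (∀ Γ, Forces (tau A) .var Γ ↔ N4Der Γ.1 A) ∧
      ∀ Γ, Forces (tauNeg A) .var Γ ↔ N4Der Γ.1 (.neg A) := by
  -- The quantifier cases need instances `A'.subst x (.var w)`, which are not subformulas but have
  -- the size of `A'`.
  induction hn : A.size using Nat.strong_induction_on generalizing A with
  | _ n ih =>
  subst hn
  have inst (A' : NForm v) (x : ℕ) (h : A'.size < A.size) :
      (∀ᶠ w in atTop, ∀ Γ, Forces (tau A') (Function.update .var x (.var w)) Γ ↔
        N4Der Γ.1 (A'.subst x (.var w))) ∧
      ∀ᶠ w in atTop, ∀ Γ, Forces (tauNeg A') (Function.update .var x (.var w)) Γ ↔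
        N4Der Γ.1 (.neg (A'.subst x (.var w))) := by
    constructor <;> filter_upwards [A'.eventually_freeFor x] with w hw Γ
    · rw [← (ih _ (by rwa [NForm.size_subst]) (A'.subst x (.var w)) rfl).1, tau_subst,
        forces_subst hw.tau, Term.eval]
    · rw [← (ih _ (by rwa [NForm.size_subst]) (A'.subst x (.var w)) rfl).2, tauNeg_subst,
        forces_subst hw.tauNeg, Term.eval]
  cases A with
  | atom P ts => simp [tau, tauNeg, Forces, IPred.literal, Term.eval_var]
  | neg A =>
      obtain ⟨h₁, h₂⟩ := ih A.size (by simp [NForm.size]) A rfl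
      exact ⟨h₂, fun Γ => (h₁ Γ).trans ⟨.negNegI, .negNegE⟩⟩
  | and A B =>
      obtain ⟨hA, hA'⟩ := ih A.size (by rw [NForm.size]; omega) A rfl
      obtain ⟨hB, hB'⟩ := ih B.size (by rw [NForm.size]; omega) B rfl
      exact ⟨fun Γ => (and_congr (hA Γ) (hB Γ)).trans
          ⟨fun h => .andI h.1 h.2, fun h => ⟨.andE₁ h, .andE₂ h⟩⟩,
        forces_or_iff hA' hB' .negAndI₁ .negAndI₂ .negAndE⟩
  | or A B =>
      obtain ⟨hA, hA'⟩ := ih A.size (by rw [NForm.size]; omega) A rfl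
      obtain ⟨hB, hB'⟩ := ih B.size (by rw [NForm.size]; omega) B rfl
      exact ⟨forces_or_iff hA hB .orI₁ .orI₂ .orE,
        fun Γ => (and_congr (hA' Γ) (hB' Γ)).trans
          ⟨fun h => .negOrI h.1 h.2, fun h => ⟨.negOrE₁ h, .negOrE₂ h⟩⟩⟩
  | imp A B =>
      obtain ⟨hA, hA'⟩ := ih A.size (by rw [NForm.size]; omega) A rfl
      obtain ⟨hB, hB'⟩ := ih B.size (by rw [NForm.size]; omega) B rfl
      exact ⟨forces_imp_iff hA hB,
        fun Γ => (and_congr (hA Γ) (hB' Γ)).trans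
          ⟨fun h => .negImpI h.1 h.2, fun h => ⟨.negImpE₁ h, .negImpE₂ h⟩⟩⟩
  | all x A =>
      obtain ⟨h₁, h₂⟩ := inst A x (by simp [NForm.size])
      have free := A.eventually_freeFor x
      have eigen := A.eventually_eigen x
      exact ⟨forces_all_iff h₁ (eigen.mono fun w hw Γ => .all_intro hw)
          (free.mono fun w hw Γ => .all_elim hw),
        forces_ex_iff h₂ (free.mono fun w hw Γ => .neg_all_intro hw)
          (eigen.mono fun w hw Γ C hΓ hC => .neg_all_elim hw hC hΓ)⟩
  | ex x A =>
      obtain ⟨h₁, h₂⟩ := inst A x (by simp [NForm.size])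
      have free := A.eventually_freeFor x
      have eigen := A.eventually_eigen x
      exact ⟨forces_ex_iff h₁ (free.mono fun w hw Γ => .ex_intro hw)
          (eigen.mono fun w hw Γ C hΓ hC => .ex_elim hw hC hΓ),
        forces_all_iff h₂ (eigen.mono fun w hw Γ => .neg_ex_intro hw)
          (free.mono fun w hw Γ => .neg_ex_elim hw)⟩

theorem n4Der_iff_intDer_tau (A : NForm v) : N4Der ∅ A ↔ IntDer ∅ (tau A) := by
  constructor
  · intro h
    simpa only [Set.image_empty] using h.toInt
  · intro h
    let Γ : World v := ⟨∅, .of_forall fun _ _ hB => hB.elim⟩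
    exact ((forces_tau_and_tauNeg_iff A).1 Γ).1 (h.sound .var Γ fun _ hB => hB.elim)

end Nelson

theorem theorem1 :
    (∀ A : Nelson.NForm .ordinary, Nelson.ProvN4 A ↔ Nelson.ProvInt (Nelson.tau A)) ∧
    (∀ (e : Bool) (A : Nelson.NForm (.free e)),
      Nelson.ProvN4NF e A ↔ Nelson.ProvIntNF e (Nelson.tau A)) :=
  ⟨Nelson.n4Der_iff_intDer_tau, fun _ => Nelson.n4Der_iff_intDer_tau⟩
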